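/- **Conventions.** A (unital) spectral triple $(\mathcal A,H,D)$ is a unital $*$-algebra $\mathcal A$ with a faithful $*$-representation on a Hilbert space $H$ and a densely defined selfadjoint operator $D$ on $H$ with compact resolvent, such that $a(\mathrm{Dom}\,D)\subseteq\mathrm{Dom}\,D$ and $[D,a]$ is bounded for all $a\in\mathcal A$; its $C^*$-completion $A$ is the norm closure of $\mathcal A$ in $B(H)$. For a bounded operator $T$ let $\sigma_n(T)$ be the sum of the $n$ largest eigenvalues of $|T|$ (with multiplicity), let $\sigma_u(T)$ for real $u\ge 0$ be its linear interpolation, and put $\tau_r(T)=\frac1{\log r}\int_e^r\frac{\sigma_u(T)}{\log u}\frac{du}{u}$. A positive compact operator $T$ with $\sup_{u>e}\sigma_u(T)/\log u<\infty$ is *measurable* if $\lim_{r\to\infty}\tau_r(T)$ exists; this limit, the common value of the Dixmier traces of $T$, is the noncommutative integral $-\!\!\!\!\!\!\int T$. For $p>0$, $|D|^{-p}$ denotes the bounded operator that acts as $|\lambda|^{-p}$ on the $\lambda$-eigenspace of $D$ for $\lambda\neq0$ and as $0$ on $\ker D$. A finite noncommutative covering projection $(A,\widetilde A,G)$ consists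 of unital $C^*$-algebras, an injective $*$-homomorphism $A\to\widetilde A$ and an action of a finite group $G$ on $\widetilde A$ by $*$-automorphisms such that $\widetilde A^G=A$; left multiplications by elements of $\widetilde A$ are compact operators of the Hilbert $A$-module $\widetilde A_A$ with product $\langle a,b\rangle=\frac1{|G|}\sum_{g}g(a^*b)$; and there are countable families $(a_\iota),(b_\iota)$ in $\widetilde A$ such that $\sum_\iota a_\iota(gb_\iota)$ converges strictly to $1$ for $g=1$ and to $0$ for $g\ne1$. Let $(\mathcal A,H,D)$ and $(\widetilde{\mathcal A},\widetilde H,\widetilde D)$ be spectral triples with $C^*$-completions $A$, $\widetilde A$. They form a *local covering projection of spectral triples* with group $G$ if there is a finite noncommutative covering projection $(A,\widetilde A,G)$ with $G\widetilde{\mathcal A}=\widetilde{\mathcal A}$, a unitary action of $G$ on $\widetilde H$ with $g(a\xi)=(ga)(g\xi)$ for $a \in \widetilde A$, $\xi \in \widetilde H$ and with $g\widetilde D=\widetilde D g$ for all $g\in G$, a bounded $A$-linear map $H\to\widetilde H$ through which $H$ is regarded as a subspace of $\widetilde H$, and a subspace $\widehat H\subset\widetilde H$ such that $\widetilde H=\bigoplus_{g\in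 G}g\widehat H$ orthogonally, $\varphi(\xi)=\sum_{g\in G}g\xi$ defines a linear isomorphism $\varphi:\widehat H\to H$, bounded with bounded inverse, and (a) $\mathrm{Dom}\,\widetilde D\cap\widehat H=\varphi^{-1}(\mathrm{Dom}\,D)$; (b) $\widetilde D(\mathrm{Dom}\,\widetilde D\cap\widehat H)\subset\widehat H$; (c) $D\varphi(\xi)=\varphi(\widetilde D\xi)$ for all $\xi\in\widehat H\cap\mathrm{Dom}\,\widetilde D$. **Lemma.** If $(\mathcal A,H,D)$ and $(\widetilde{\mathcal A},\widetilde H,\widetilde D)$ form a local covering projection of spectral triples with group $G$, then for every real $p>0$ the operator $|D|^{-p}$ is measurable if and only if $|\widetilde D|^{-p}$ is, and in that case $$-\!\!\!\!\!\!\int |\widetilde D|^{-p}=|G|\;-\!\!\!\!\!\!\int |D|^{-p}.$$ -/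

import Mathlib

noncomputable section

namespace NCCovering

/-! ### Spectral triples -/

section Triple

variable {H : Type*} [NormedAddCommGroup H] [InnerProductSpace ℂ H]

/-- `R` is the bounded everywhere defined inverse `(D - z)⁻¹` of `D - z`; such an `R` exists
exactly when `z` does not belong to the spectrum of `D`. -/
structure IsResolventAt (D : H →ₗ.[ℂ] H) (z : ℂ) (R : H →L[ℂ] H) : Prop where
  right_inv : ∀ y : H, ∃ h : R y ∈ D.domain, D ⟨R y, h⟩ - z • R y = y
  left_inv : ∀ x : D.domain, R (D x - z • (x : H)) = x

/-- A unital spectral triple `(𝒜, H, D)`: a unital `*`-algebra with a faithful `*`-representation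
on the Hilbert space `H`, and a densely defined selfadjoint operator `D` with compact resolvent
whose domain is preserved by `𝒜` and whose commutators with elements of `𝒜` are bounded. -/
structure SpectralTriple (𝒜 : Type*) [Ring 𝒜] [StarRing 𝒜] [Algebra ℂ 𝒜] [StarModule ℂ 𝒜]
    (H : Type*) [NormedAddCommGroup H] [InnerProductSpace ℂ H] [CompleteSpace H] where
  rep : 𝒜 →⋆ₐ[ℂ] (H →L[ℂ] H)
  rep_injective : Function.Injective rep
  D : H →ₗ.[ℂ] H
  dense_domain : Dense (D.domain : Set H)
  selfAdjoint : IsSelfAdjoint D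
  rep_mem_domain : ∀ (a : 𝒜) (x : D.domain), rep a x ∈ D.domain
  bounded_commutator : ∀ a : 𝒜, ∃ B : H →L[ℂ] H, ∀ x : D.domain,
    D ⟨rep a x, rep_mem_domain a x⟩ - rep a (D x) = B x
  compact_resolvent : ∀ (z : ℂ) (R : H →L[ℂ] H), IsResolventAt D z R → IsCompactOperator R

variable {𝒜 : Type*} [Ring 𝒜] [StarRing 𝒜] [Algebra ℂ 𝒜] [StarModule ℂ 𝒜] [CompleteSpace H]

/-- The `C*`-completion of the algebra of a spectral triple: the norm closure of its image in
the bounded operators. -/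
def SpectralTriple.completion (T : SpectralTriple 𝒜 H) : StarSubalgebra ℂ (H →L[ℂ] H) :=
  T.rep.range.topologicalClosure

instance (T : SpectralTriple 𝒜 H) : CStarAlgebra T.completion :=
  StarSubalgebra.cstarAlgebra _
    (h_closed := StarSubalgebra.isClosed_topologicalClosure T.rep.range)

theorem SpectralTriple.rep_mem_completion (T : SpectralTriple 𝒜 H) (a : 𝒜) :
    T.rep a ∈ T.completion :=
  StarSubalgebra.le_topologicalClosure _ ⟨a, rfl⟩

/-- An element of `𝒜` regarded as an element of the completion. -/
def SpectralTriple.toCompletion (T : SpectralTriple 𝒜 H) (a : 𝒜) : T.completion :=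
  ⟨T.rep a, T.rep_mem_completion a⟩

end Triple

/-! ### The noncommutative integral -/

section Integral

variable {H : Type*} [NormedAddCommGroup H] [InnerProductSpace ℂ H] [CompleteSpace H]

/-- The `k`-th (counting from `k = 0`) eigenvalue of `|T| = (T* T)^{1/2}` in decreasing order with
multiplicities: the largest `t` such that `|T|` has `k + 1` linearly independent eigenvectors
with eigenvalues `≥ t` (and `0` when `H` has dimension at most `k`). -/
def singularValue (T : H →L[ℂ] H) (k : ℕ) : ℝ :=
  sSup {t : ℝ | 0 ≤ t ∧ ∃ v : Fin (k + 1) → H, LinearIndependent ℂ v ∧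
    ∀ i, ∃ s : ℝ, t ≤ s ∧ CFC.abs T (v i) = (s : ℂ) • v i}

/-- `σ_n(T)`, the sum of the `n` largest eigenvalues of `|T|`. -/
def sigmaNat (T : H →L[ℂ] H) (n : ℕ) : ℝ := ∑ k ∈ Finset.range n, singularValue T k

/-- `σ_u(T)` for a real scale `u ≥ 0`, interpolated linearly between consecutive integers. -/
def sigma (T : H →L[ℂ] H) (u : ℝ) : ℝ :=
  (1 - Int.fract u) * sigmaNat T ⌊u⌋₊ + Int.fract u * sigmaNat T (⌊u⌋₊ + 1)

/-- The Cesàro mean `τ_r(T) = (log r)⁻¹ ∫_e^r σ_u(T) / log u du / u`. -/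
def tau (T : H →L[ℂ] H) (r : ℝ) : ℝ :=
  (1 / Real.log r) * ∫ u in (Real.exp 1)..r, sigma T u / Real.log u * (1 / u)

/-- The Dixmier ideal `𝓛^{1+}`: the compact operators `T` with `sup_{u > e} σ_u(T) / log u < ∞`. -/
def MemDixmierIdeal (T : H →L[ℂ] H) : Prop :=
  IsCompactOperator T ∧ ∃ C : ℝ, ∀ u : ℝ, Real.exp 1 < u → sigma T u / Real.log u ≤ C

/-- The positive operator `T` belongs to the Dixmier ideal, is measurable, and its noncommutative
integral, the common value of its Dixmier traces, is `c = lim_{r → ∞} τ_r(T)`. -/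
structure HasNCIntegral (T : H →L[ℂ] H) (c : ℝ) : Prop where
  isPositive : T.IsPositive
  mem : MemDixmierIdeal T
  tendsto : Filter.Tendsto (tau T) Filter.atTop (nhds c)

/-- `T = |D|^{-p}`, with the convention that it vanishes on `ker D`: the bounded operator `T` with
`T x = |l|^{-p} x` for every eigenvector `x` of `D` with eigenvalue `l ≠ 0`, and `T x = 0` for
`x ∈ ker D`. As a selfadjoint operator `D` with compact resolvent has an orthonormal basis of
eigenvectors, these equations determine `T`. -/
def IsAbsNegPow (D : H →ₗ.[ℂ] H) (p : ℝ) (T : H →L[ℂ] H) : Prop :=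
  ∀ (l : ℝ) (x : D.domain), D x = (l : ℂ) • (x : H) →
    T x = ((if l = 0 then 0 else |l| ^ (-p) : ℝ) : ℂ) • (x : H)

/-- The operator `|D|^{-p}` is measurable and `c` is its noncommutative integral. -/
def SpectralTriple.HasDiracIntegral {𝒜 : Type*} [Ring 𝒜] [StarRing 𝒜] [Algebra ℂ 𝒜]
    [StarModule ℂ 𝒜] (S : SpectralTriple 𝒜 H) (p : ℝ) (c : ℝ) : Prop :=
  ∃ T : H →L[ℂ] H, IsAbsNegPow S.D p T ∧ HasNCIntegral T c

end Integral

/-! ### Finite noncommutative covering projections -/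

section Covering

/-- The product `⟨a, b⟩ = |G|⁻¹ ∑_g g (a* b)` induced by a group action; its values are
`G`-invariant. -/
def covInner {B G : Type*} [CStarAlgebra B] [Group G] [Fintype G] (act : G →* (B ≃⋆ₐ[ℂ] B))
    (a b : B) : B :=
  (Fintype.card G : ℂ)⁻¹ • ∑ g : G, act g (star a * b)

/-- The Hilbert module norm `‖a‖ = ‖⟨a, a⟩‖^{1/2}`. -/
def covNorm {B G : Type*} [CStarAlgebra B] [Group G] [Fintype G] (act : G →* (B ≃⋆ₐ[ℂ] B))
    (a : B) : ℝ :=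
  Real.sqrt ‖covInner act a a‖

/-- The map `F` is a compact operator of the Hilbert module `B` over the invariants: in the
operator norm of the Hilbert module it is a limit of finite sums of rank one operators
`z ↦ x ⟨y, z⟩`. -/
def IsCompactModuleMap {B G : Type*} [CStarAlgebra B] [Group G] [Fintype G]
    (act : G →* (B ≃⋆ₐ[ℂ] B)) (F : B → B) : Prop :=
  ∀ ε : ℝ, 0 < ε → ∃ (n : ℕ) (x y : Fin n → B), ∀ z : B,
    covNorm act (F z - ∑ i, x i * covInner act (y i) z) ≤ ε * covNorm act z

/-- A finite noncommutative covering projection `(A, B, G)` of unital `C*`-algebras. The series in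
`partition` converge strictly in the multiplier algebra of `B`. -/
structure FiniteCovering (A B G : Type*) [CStarAlgebra A] [CStarAlgebra B] [Group G]
    [Fintype G] where
  incl : A →⋆ₐ[ℂ] B
  incl_injective : Function.Injective incl
  act : G →* (B ≃⋆ₐ[ℂ] B)
  invariants : ∀ b : B, (∀ g : G, act g b = b) ↔ ∃ a : A, incl a = b
  compact : ∀ b : B, IsCompactModuleMap act (fun z => b * z)
  partition : ∃ (I : Type) (_ : Countable I) (a b : I → B), ∀ (g : G) (c : B),
    (g = 1 → HasSum (fun i => a i * act g (b i) * c) c ∧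
      HasSum (fun i => c * (a i * act g (b i))) c) ∧
    (g ≠ 1 → HasSum (fun i => a i * act g (b i) * c) 0 ∧
      HasSum (fun i => c * (a i * act g (b i))) 0)

/-- A local covering projection of spectral triples from `S' = (𝒜', H', D')` to
`S = (𝒜, H, D)` with group `G`.

The group acts on the covering Hilbert space by unitaries which are compatible with its action on
the algebra and commute with the Dirac operator, and `emb` is the embedding of `H` into `H'`
that is used to regard `∑_g g ξ` as an element of `H`; it need not be isometric, so that either
normalization of the scalar product of `H'` is allowed. -/
structure LocalCovering {𝒜 𝒜' H H' : Type*}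
    [Ring 𝒜] [StarRing 𝒜] [Algebra ℂ 𝒜] [StarModule ℂ 𝒜]
    [Ring 𝒜'] [StarRing 𝒜'] [Algebra ℂ 𝒜'] [StarModule ℂ 𝒜']
    [NormedAddCommGroup H] [InnerProductSpace ℂ H] [CompleteSpace H]
    [NormedAddCommGroup H'] [InnerProductSpace ℂ H'] [CompleteSpace H']
    (S : SpectralTriple 𝒜 H) (S' : SpectralTriple 𝒜' H')
    (G : Type*) [Group G] [Fintype G] where
  /-- The finite covering projection of the `C*`-completions. -/
  cov : FiniteCovering S.completion S'.completion G
  /-- The group preserves the smooth algebra `𝒜'`. -/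
  act_smooth : ∀ (g : G) (a : 𝒜'), ∃ b : 𝒜', cov.act g (S'.toCompletion a) = S'.toCompletion b
  /-- The unitary action of the group on `H'`. -/
  U : G →* (H' ≃ₗᵢ[ℂ] H')
  covariant : ∀ (g : G) (a : S'.completion) (ξ : H'),
    U g ((a : H' →L[ℂ] H') ξ) = (cov.act g a : H' →L[ℂ] H') (U g ξ)
  equivariant_mem : ∀ (g : G) (ξ : S'.D.domain), U g ξ ∈ S'.D.domain
  equivariant : ∀ (g : G) (ξ : S'.D.domain), S'.D ⟨U g ξ, equivariant_mem g ξ⟩ = U g (S'.D ξ)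
  /-- The embedding of `H` into `H'`. -/
  emb : H →L[ℂ] H'
  emb_rep : ∀ (a : S.completion) (ξ : H),
    emb ((a : H →L[ℂ] H) ξ) = (cov.incl a : H' →L[ℂ] H') (emb ξ)
  /-- The subspace `Ĥ`, whose translates decompose `H'` into an orthogonal direct sum. -/
  hat : Submodule ℂ H'
  orthogonal : ∀ g h : G, g ≠ h → ∀ ξ ∈ hat, ∀ η ∈ hat, inner ℂ (U g ξ) (U h η) = 0
  spanning : (⨆ g : G, hat.map (U g).toLinearEquiv.toLinearMap) = ⊤
  /-- The isomorphism `φ : Ĥ → H`, `ξ ↦ ∑_g g ξ`. -/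
  φ : hat ≃L[ℂ] H
  φ_spec : ∀ ξ : hat, emb (φ ξ) = ∑ g : G, U g ξ
  /-- Condition (a): `Dom D' ∩ Ĥ = φ⁻¹ (Dom D)`. -/
  domain_iff : ∀ ξ : hat, (ξ : H') ∈ S'.D.domain ↔ φ ξ ∈ S.D.domain
  /-- Condition (b): `D' (Dom D' ∩ Ĥ) ⊆ Ĥ`. -/
  map_hat : ∀ (ξ : hat) (h : (ξ : H') ∈ S'.D.domain), S'.D ⟨ξ, h⟩ ∈ hat
  /-- Condition (c): `D (φ ξ) = φ (D' ξ)` for `ξ ∈ Dom D' ∩ Ĥ`. -/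
  dirac_comm : ∀ (ξ : hat) (h : (ξ : H') ∈ S'.D.domain),
    S.D ⟨φ ξ, (domain_iff ξ).1 h⟩ = φ ⟨S'.D ⟨ξ, h⟩, map_hat ξ h⟩

end Covering

end NCCovering

end

/-! The translates `g Ĥ` split `H'` orthogonally, and each is a copy of `H` through the sheet `g
φ⁻¹`, which carries eigenvectors of `D` to eigenvectors of `D'` with the same eigenvalue.
Eigenvectors of `D` have dense span (`dense_iSup_diracEigenspace`), so `T' = |D'|^{-p}` is similar
to the direct sum of `n = |G|` copies of `T = |D|^{-p}`. Sheets need not be isometric; but both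
operators are positive, so their singular values are read off from dimensions of spans of
eigenvectors, which any linear isomorphism respects. Hence `s_k(T') = s_{⌊k/n⌋}(T)`
(`singularValue_of_similar`) and `σ_{nu}(T') = n σ_u(T)` (`sigma_mul`).

The substitution `u = nv` turns `τ_r(T')` into `n / log r` times the integral of `σ_v(T) / log (nv)
dv/v` from `e/n` to `r/n`. Replacing `log (nv)` by `log v` and the limits by `e` and `r` costs
`O(log log r)` when `σ_u(T) = O(log u)`. After division by `log r` this vanishes, so `τ_r(T') - n
τ_r(T) → 0` (`tendsto_tau_sub`), whether or not either mean converges. This gives both directions at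
once. -/

noncomputable section

namespace NCCovering

open scoped InnerProductSpace ComplexConjugate ComplexOrder

/-! ### Spectral theory of selfadjoint operators with compact resolvent -/

section Spectral

variable {H : Type*} [NormedAddCommGroup H] [InnerProductSpace ℂ H]

/-- The eigenspace of an unbounded operator at a real number. -/
def diracEigenspace (D : H →ₗ.[ℂ] H) (l : ℝ) : Submodule ℂ H where
  carrier := {x | ∃ h : x ∈ D.domain, D ⟨x, h⟩ = (l : ℂ) • x}
  zero_mem' := ⟨D.domain.zero_mem, by
    rw [show (⟨0, D.domain.zero_mem⟩ : D.domain) = 0 from rfl, D.map_zero, smul_zero]⟩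
  add_mem' := by
    rintro x y ⟨hx, hx'⟩ ⟨hy, hy'⟩
    refine ⟨D.domain.add_mem hx hy, ?_⟩
    rw [smul_add, ← hx', ← hy', ← D.map_add]
    rfl
  smul_mem' := by
    rintro c x ⟨hx, hx'⟩
    refine ⟨D.domain.smul_mem c hx, ?_⟩
    rw [smul_comm, ← hx', ← D.map_smul]
    rfl

theorem isAbsNegPow_iff {D : H →ₗ.[ℂ] H} {p : ℝ} {T : H →L[ℂ] H} :
    IsAbsNegPow D p T ↔ ∀ l : ℝ, ∀ x ∈ diracEigenspace D l,
      T x = ((if l = 0 then 0 else |l| ^ (-p) : ℝ) : ℂ) • x :=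
  ⟨fun h l x hx => h l ⟨x, hx.1⟩ hx.2, fun h l x hx => h l x ⟨x.2, hx⟩⟩

theorem IsResolventAt.mem_domain {D : H →ₗ.[ℂ] H} {z : ℂ} {R : H →L[ℂ] H}
    (hR : IsResolventAt D z R) (y : H) : R y ∈ D.domain := (hR.right_inv y).1

/-- The defining identity of the resolvent in the form `D R y = y + z R y`. -/
theorem IsResolventAt.apply_eq {D : H →ₗ.[ℂ] H} {z : ℂ} {R : H →L[ℂ] H}
    (hR : IsResolventAt D z R) (y : H) : D ⟨R y, hR.mem_domain y⟩ = y + z • R y :=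
  sub_eq_iff_eq_add.1 (hR.right_inv y).2

theorem inner_symm_of_isSelfAdjoint [CompleteSpace H] {D : H →ₗ.[ℂ] H} (hD : IsSelfAdjoint D)
    (x y : D.domain) : ⟪D x, (y : H)⟫_ℂ = ⟪(x : H), D y⟫_ℂ := by
  have h := LinearPMap.adjoint_isFormalAdjoint hD.dense_domain
  rw [LinearPMap.isSelfAdjoint_def.1 hD] at h
  exact h x y

/-- The cross term vanishes because `⟪D x, x⟫` is real and `z` is imaginary. The identity bounds `D
- z` from below when `z ≠ 0`. -/
theorem norm_sq_sub_smul [CompleteSpace H] {D : H →ₗ.[ℂ] H} (hD : IsSelfAdjoint D) {z : ℂ}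
    (hz : z.re = 0) (x : D.domain) :
    ‖D x - z • (x : H)‖ ^ 2 = ‖D x‖ ^ 2 + ‖z‖ ^ 2 * ‖(x : H)‖ ^ 2 := by
  have h1 : (⟪D x, (x : H)⟫_ℂ).im = 0 := by
    have h := inner_conj_symm (𝕜 := ℂ) (D x) (x : H)
    rw [← inner_symm_of_isSelfAdjoint hD] at h
    exact Complex.conj_eq_iff_im.1 h
  rw [@norm_sub_sq ℂ, inner_smul_right, norm_smul, mul_pow]
  simp [hz, h1]

/-- A selfadjoint operator has a resolvent at every nonzero imaginary number. -/
theorem exists_isResolventAt [CompleteSpace H] {D : H →ₗ.[ℂ] H} (hD : IsSelfAdjoint D) {z : ℂ}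
    (hz : z.re = 0) (hz' : z ≠ 0) : ∃ R : H →L[ℂ] H, IsResolventAt D z R := by
  -- `D - z` becomes a bounded operator `F` on the graph of `D`, which is complete because a
  -- selfadjoint operator is closed.
  have hclosed : IsClosed (D.graph : Set (H × H)) := hD.isClosed
  have : CompleteSpace D.graph := hclosed.completeSpace_coe
  let F : D.graph →L[ℂ] H :=
    ((ContinuousLinearMap.snd ℂ H H) - z • (ContinuousLinearMap.fst ℂ H H)).comp D.graph.subtypeL
  have hF : ∀ x : D.graph, F x = (x : H × H).2 - z • (x : H × H).1 := fun x => rfl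
  have hmk : ∀ x : D.domain, ((x : H), D x) ∈ D.graph := fun x => D.mem_graph x
  have hnz : 0 < ‖z‖ := norm_pos_iff.2 hz'
  -- The graph carries the max norm of `H × H`: the constant `1` controls `D x` and `‖z‖⁻¹` controls
  -- `x`.
  have hbound : ∀ x : D.graph, ‖x‖ ≤ (max 1 ‖z‖⁻¹) * ‖F x‖ := by
    rintro ⟨⟨x, y⟩, hxy⟩
    obtain ⟨u, rfl, rfl⟩ := (D.mem_graph_iff).1 hxy
    have h := norm_sq_sub_smul hD hz u
    rw [hF]
    simp only
    have h1 : ‖D u‖ ≤ ‖D u - z • (u : H)‖ := by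
      refine le_of_sq_le_sq ?_ (norm_nonneg _)
      nlinarith [mul_nonneg (sq_nonneg ‖z‖) (sq_nonneg ‖(u : H)‖)]
    have h2 : ‖z‖ * ‖(u : H)‖ ≤ ‖D u - z • (u : H)‖ := by
      refine le_of_sq_le_sq ?_ (norm_nonneg _)
      nlinarith [sq_nonneg ‖D u‖]
    have h3 : ‖(u : H)‖ ≤ ‖z‖⁻¹ * ‖D u - z • (u : H)‖ := by
      rw [inv_mul_eq_div, le_div_iff₀ hnz]
      linarith
    refine max_le (h3.trans ?_) (h1.trans ?_)
    · gcongr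
      exact le_max_right _ _
    · exact le_mul_of_one_le_left (norm_nonneg _) (le_max_left _ _)
  have hanti : AntilipschitzWith ⟨max 1 ‖z‖⁻¹, by positivity⟩ F :=
    AddMonoidHomClass.antilipschitz_of_bound F hbound
  have hker : F.ker = ⊥ := LinearMap.ker_eq_bot.2 hanti.injective
  have hcl : IsClosed (F.range : Set H) := by
    have := hanti.isClosed_range F.uniformContinuous
    rwa [← ContinuousLinearMap.coe_coe, ← LinearMap.coe_range] at this
  -- The range is closed. A vector `y` orthogonal to it lies in the domain of the adjoint, which is
  -- `D`, and satisfies `D y = conj z • y`; the norm identity at `conj z` then forces `y = 0`.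
  have hran : F.range = ⊤ := by
    have : CompleteSpace F.range := hcl.completeSpace_coe
    rw [← Submodule.orthogonal_eq_bot_iff, Submodule.eq_bot_iff]
    intro y hy
    have hy' : ∀ x : D.domain, ⟪conj z • y, (x : H)⟫_ℂ = ⟪y, D x⟫_ℂ := by
      intro x
      have h := (Submodule.mem_orthogonal' _ _).1 hy (F ⟨_, hmk x⟩) ⟨_, rfl⟩
      rw [hF, inner_sub_right, inner_smul_right, sub_eq_zero] at h
      rw [inner_smul_left, Complex.conj_conj, h]
    have hmem : y ∈ D.domain := by
      have := LinearPMap.mem_adjoint_domain_of_exists y ⟨_, hy'⟩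
      rwa [LinearPMap.isSelfAdjoint_def.1 hD] at this
    have hDy : D ⟨y, hmem⟩ = conj z • y := by
      refine hD.dense_domain.eq_of_inner_left ℂ fun x hx => ?_
      rw [hy' ⟨x, hx⟩]
      exact inner_symm_of_isSelfAdjoint hD ⟨y, hmem⟩ ⟨x, hx⟩
    have hre : (conj z).re = 0 := by simpa using hz
    have h := norm_sq_sub_smul hD hre ⟨y, hmem⟩
    rw [hDy] at h
    simp only [sub_self, norm_zero, norm_smul] at h
    have h0 : (‖conj z‖ * ‖y‖) ^ 2 = 0 := by nlinarith [sq_nonneg (‖conj z‖ * ‖y‖)]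
    have h1 : ‖conj z‖ ≠ 0 := by simpa using hz'
    simpa [h1, hz'] using h0
  let e := ContinuousLinearEquiv.ofBijective F hker hran
  refine ⟨((ContinuousLinearMap.fst ℂ H H).comp D.graph.subtypeL).comp e.symm.toContinuousLinearMap,
    ⟨fun y => ?_, fun x => ?_⟩⟩
  · have h1 : F (e.symm y) = y := e.apply_symm_apply y
    obtain ⟨u, hu, hu'⟩ := (D.mem_graph_iff).1 (e.symm y).2
    have hmem : ((e.symm y : D.graph) : H × H).1 ∈ D.domain := hu ▸ u.2
    refine ⟨hmem, ?_⟩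
    have : D ⟨_, hmem⟩ = ((e.symm y : D.graph) : H × H).2 := by
      rw [← hu']
      congr 1
      exact Subtype.ext hu.symm
    exact (congrArg (· - z • ((e.symm y : D.graph) : H × H).1) this).trans h1
  · have h1 : e.symm (F ⟨_, hmk x⟩) = ⟨_, hmk x⟩ := e.symm_apply_apply _
    change ((e.symm (F ⟨_, hmk x⟩) : D.graph) : H × H).1 = x
    rw [h1]

/-- If `D² x = ν x` with `x ≠ 0` then `x` is a combination of two eigenvectors of `D`. -/
theorem mem_iSup_diracEigenspace_of_sq [CompleteSpace H] {D : H →ₗ.[ℂ] H} (hD : IsSelfAdjoint D)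
    {x : H} (hx : x ∈ D.domain) (hDx : D ⟨x, hx⟩ ∈ D.domain) {ν : ℂ}
    (h : D ⟨D ⟨x, hx⟩, hDx⟩ = ν • x) : x ∈ ⨆ l, diracEigenspace D l := by
  by_cases hx0 : x = 0
  · rw [hx0]
    exact Submodule.zero_mem _
  have hn : (‖x‖ : ℂ) ^ 2 ≠ 0 := by simpa using hx0
  -- Pairing with `x` gives `ν = ‖D x‖² / ‖x‖² ≥ 0`, so `ν` has a real square root `κ`.
  have h1 : ν * (‖x‖ : ℂ) ^ 2 = (‖D ⟨x, hx⟩‖ : ℂ) ^ 2 := by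
    have h2 := inner_symm_of_isSelfAdjoint hD ⟨x, hx⟩ ⟨D ⟨x, hx⟩, hDx⟩
    rw [h, inner_smul_right] at h2
    simp only [inner_self_eq_norm_sq_to_K] at h2
    exact h2.symm
  obtain ⟨κ, hκ⟩ : ∃ κ : ℝ, ν = (κ : ℂ) ^ 2 := by
    refine ⟨‖D ⟨x, hx⟩‖ / ‖x‖, ?_⟩
    push_cast
    rw [div_pow, eq_div_iff hn, h1]
  by_cases hκ0 : κ = 0
  · have h2 : D ⟨x, hx⟩ = 0 := by
      rw [hκ, hκ0] at h1
      simpa using h1.symm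
    exact Submodule.mem_iSup_of_mem 0 ⟨hx, by simpa using h2⟩
  -- `(D - s)(D + s) x = (D² - κ²) x = 0` for `s = ±κ`; the two resulting eigenvectors differ by `2κ
  -- x`.
  have key : ∀ s : ℝ, s ^ 2 = κ ^ 2 → D ⟨x, hx⟩ + (s : ℂ) • x ∈ diracEigenspace D s := by
    intro s hs
    refine ⟨D.domain.add_mem hDx (D.domain.smul_mem _ hx), ?_⟩
    have h2 : D (⟨D ⟨x, hx⟩, hDx⟩ + (s : ℂ) • ⟨x, hx⟩) = ν • x + (s : ℂ) • D ⟨x, hx⟩ := by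
      rw [D.map_add, D.map_smul, h]
    refine h2.trans ?_
    have h3 : ν = (s : ℂ) * s := by
      rw [hκ, ← sq]
      exact_mod_cast hs.symm
    rw [h3, smul_add, smul_smul, add_comm]
  have hκ' : (κ : ℂ) ≠ 0 := by exact_mod_cast hκ0
  have hdec : x = (2 * (κ : ℂ))⁻¹ • ((D ⟨x, hx⟩ + (κ : ℂ) • x) -
      (D ⟨x, hx⟩ + ((-κ : ℝ) : ℂ) • x)) := by
    rw [add_sub_add_left_eq_sub, ← sub_smul, smul_smul]
    push_cast
    rw [sub_neg_eq_add, ← two_mul, inv_mul_cancel₀ (mul_ne_zero two_ne_zero hκ'), one_smul]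
  rw [hdec]
  exact Submodule.smul_mem _ _ (Submodule.sub_mem _
    (Submodule.mem_iSup_of_mem _ (key κ rfl)) (Submodule.mem_iSup_of_mem _ (key (-κ) (by ring))))

/-- The eigenvectors of a selfadjoint operator with compact resolvent have dense span. -/
theorem dense_iSup_diracEigenspace [CompleteSpace H] {D : H →ₗ.[ℂ] H} (hD : IsSelfAdjoint D)
    (hc : ∀ (z : ℂ) (R : H →L[ℂ] H), IsResolventAt D z R → IsCompactOperator R) :
    Dense ((⨆ l, diracEigenspace D l : Submodule ℂ H) : Set H) := by
  obtain ⟨R, hR⟩ := exists_isResolventAt hD (z := Complex.I) (by simp) (by simp)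
  obtain ⟨Q, hQ⟩ := exists_isResolventAt hD (z := -Complex.I) (by simp) (by simp)
  -- K = (D² + 1)⁻¹
  set K : H →L[ℂ] H := R.comp Q with hK
  have hKdom : ∀ y, K y ∈ D.domain := fun y => hR.mem_domain _
  have hDK : ∀ y, D ⟨K y, hKdom y⟩ = Q y + Complex.I • K y := fun y => hR.apply_eq _
  have hDKdom : ∀ y, D ⟨K y, hKdom y⟩ ∈ D.domain := fun y => by
    rw [hDK]
    exact D.domain.add_mem (hQ.mem_domain y) (D.domain.smul_mem _ (hKdom y))
  have hDDK : ∀ y, D ⟨D ⟨K y, hKdom y⟩, hDKdom y⟩ = y - K y := by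
    intro y
    have h1 : (⟨D ⟨K y, hKdom y⟩, hDKdom y⟩ : D.domain) =
        ⟨Q y, hQ.mem_domain y⟩ + Complex.I • ⟨K y, hKdom y⟩ := Subtype.ext (hDK y)
    rw [h1, D.map_add, D.map_smul, hQ.apply_eq, hDK, smul_add, smul_smul, Complex.I_mul_I]
    module
  have hKc : IsCompactOperator K := (hc _ _ hR).comp_clm Q
  -- Substituting `y = K y + D² K y` gives `⟪K x, y⟫ = ⟪K x, K y⟫ + ⟪D K x, D K y⟫`, which is also
  -- what `⟪x, K y⟫` expands to.
  have hKs : (K : H →ₗ[ℂ] H).IsSymmetric := by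
    intro x y
    have hx : x = K x + D ⟨D ⟨K x, hKdom x⟩, hDKdom x⟩ := by rw [hDDK]; abel
    have hy : y = K y + D ⟨D ⟨K y, hKdom y⟩, hDKdom y⟩ := by rw [hDDK]; abel
    change ⟪K x, y⟫_ℂ = ⟪x, K y⟫_ℂ
    have h1 : ⟪K x, D ⟨D ⟨K y, hKdom y⟩, hDKdom y⟩⟫_ℂ = ⟪D ⟨K x, hKdom x⟩, D ⟨K y, hKdom y⟩⟫_ℂ :=
      (inner_symm_of_isSelfAdjoint hD ⟨K x, hKdom x⟩ ⟨_, hDKdom y⟩).symm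
    have h2 : ⟪D ⟨D ⟨K x, hKdom x⟩, hDKdom x⟩, K y⟫_ℂ = ⟪D ⟨K x, hKdom x⟩, D ⟨K y, hKdom y⟩⟫_ℂ :=
      inner_symm_of_isSelfAdjoint hD ⟨_, hDKdom x⟩ ⟨K y, hKdom y⟩
    calc ⟪K x, y⟫_ℂ = ⟪K x, K y⟫_ℂ + ⟪K x, D ⟨D ⟨K y, hKdom y⟩, hDKdom y⟩⟫_ℂ := by
          rw [← inner_add_right, ← hy]
      _ = ⟪K x, K y⟫_ℂ + ⟪D ⟨D ⟨K x, hKdom x⟩, hDKdom x⟩, K y⟫_ℂ := by rw [h1, h2]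
      _ = ⟪x, K y⟫_ℂ := by rw [← inner_add_left, ← hx]
  have horth := ContinuousLinearMap.orthogonalComplement_iSup_eigenspaces_eq_bot hKc hKs
  have hle : (⨆ μ, Module.End.eigenspace (K : Module.End ℂ H) μ) ≤ ⨆ l, diracEigenspace D l := by
    refine iSup_le fun μ x hx => ?_
    have hx' : K x = μ • x := Module.End.mem_eigenspace_iff.1 hx
    by_cases hμ : μ = 0
    · have h0 : K x = 0 := by rw [hx', hμ, zero_smul]
      have h1 := hDDK x
      have h2 : (⟨K x, hKdom x⟩ : D.domain) = 0 := Subtype.ext h0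
      have h3 : (⟨D ⟨K x, hKdom x⟩, hDKdom x⟩ : D.domain) = 0 :=
        -- `K` is injective: if `K x = 0` then `x = K x + D² K x = 0`.
        Subtype.ext (by simp only [h2, D.map_zero]; rfl)
      rw [h3, D.map_zero, h0, sub_zero] at h1
      rw [← h1]
      exact Submodule.zero_mem _
    have hmem : K x ∈ ⨆ l, diracEigenspace D l := by
      refine mem_iSup_diracEigenspace_of_sq hD (hKdom x) (hDKdom x) (ν := μ⁻¹ - 1) ?_
      rw [hDDK, sub_smul, one_smul]
      congr 1
      rw [hx', smul_smul, inv_mul_cancel₀ hμ, one_smul]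
    have : x = μ⁻¹ • K x := by rw [hx', smul_smul, inv_mul_cancel₀ hμ, one_smul]
    rw [this]
    exact Submodule.smul_mem _ _ hmem
  rw [Submodule.dense_iff_topologicalClosure_eq_top, Submodule.topologicalClosure_eq_top_iff,
    eq_bot_iff, ← horth]
  exact Submodule.orthogonal_le hle

theorem inner_eq_zero_of_mem_diracEigenspace [CompleteSpace H] {D : H →ₗ.[ℂ] H}
    (hD : IsSelfAdjoint D) {l m : ℝ} (hlm : l ≠ m) {x y : H} (hx : x ∈ diracEigenspace D l)
    (hy : y ∈ diracEigenspace D m) : ⟪x, y⟫_ℂ = 0 := by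
  obtain ⟨hx, hx'⟩ := hx
  obtain ⟨hy, hy'⟩ := hy
  have h := inner_symm_of_isSelfAdjoint hD ⟨x, hx⟩ ⟨y, hy⟩
  rw [hx', hy', inner_smul_left, inner_smul_right, Complex.conj_ofReal] at h
  have h' : ((l : ℂ) - m) * ⟪x, y⟫_ℂ = 0 := by linear_combination h
  rcases mul_eq_zero.1 h' with h0 | h0
  · exact absurd (by exact_mod_cast sub_eq_zero.1 h0) hlm
  · exact h0

/-- A bounded operator acting as `f l ≥ 0` on enough eigenvectors of `D` is the positive operator
`f D`. -/
theorem isPositive_of_dense_eigenvectors [CompleteSpace H] {D : H →ₗ.[ℂ] H}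
    (hD : IsSelfAdjoint D) {V : ℝ → Submodule ℂ H} (hV : ∀ l, V l ≤ diracEigenspace D l)
    (hd : Dense ((⨆ l, V l : Submodule ℂ H) : Set H)) {f : ℝ → ℝ} (hf : ∀ l, 0 ≤ f l)
    {T : H →L[ℂ] H} (hT : ∀ l, ∀ x ∈ V l, T x = (f l : ℂ) • x) : T.IsPositive := by
  have hpos : ∀ x : H, (0 : ℂ) ≤ ⟪T x, x⟫_ℂ := by
    intro x
    have hcl : IsClosed {x : H | (0 : ℂ) ≤ ⟪T x, x⟫_ℂ} :=
      isClosed_Ici.preimage (T.continuous.inner (𝕜 := ℂ) continuous_id)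
    refine hcl.closure_subset_iff.2 ?_ (hd x)
    intro y hy
    obtain ⟨u, hu, rfl⟩ := (Submodule.mem_iSup_iff_exists_finsupp V y).1 hy
    simp only [Set.mem_ofPred_eq, Finsupp.sum, map_sum, sum_inner, inner_sum]
    refine Finset.sum_nonneg fun j _ => Finset.sum_nonneg fun i _ => ?_
    rw [hT i _ (hu i), inner_smul_left, Complex.conj_ofReal]
    by_cases hij : i = j
    · subst hij
      rw [inner_self_eq_norm_sq_to_K]
      have := mul_nonneg (hf i) (sq_nonneg ‖u i‖)
      simp only [Complex.coe_algebraMap]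
      exact_mod_cast this
    · rw [inner_eq_zero_of_mem_diracEigenspace hD hij (hV i (hu i)) (hV j (hu j)), mul_zero]
  rw [ContinuousLinearMap.isPositive_iff_complex]
  intro x
  obtain ⟨h1, h2⟩ := Complex.le_def.1 (hpos x)
  refine ⟨Complex.ext (by simp) (by simpa using h2), by simpa using h1⟩

/-- `T` is symmetric, so `T x` can be tested against the vectors of each `V m`, where orthogonality
of eigenspaces leaves only `m = l`. Thus the eigenvectors in `V` suffice, without knowing that they
exhaust the eigenspaces. -/
theorem apply_eq_of_dense_eigenvectors [CompleteSpace H] {D : H →ₗ.[ℂ] H}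
    (hD : IsSelfAdjoint D) {V : ℝ → Submodule ℂ H} (hV : ∀ l, V l ≤ diracEigenspace D l)
    (hd : Dense ((⨆ l, V l : Submodule ℂ H) : Set H)) {f : ℝ → ℝ} (hf : ∀ l, 0 ≤ f l)
    {T : H →L[ℂ] H} (hT : ∀ l, ∀ x ∈ V l, T x = (f l : ℂ) • x) {l : ℝ} {x : H}
    (hx : x ∈ diracEigenspace D l) : T x = (f l : ℂ) • x := by
  have hs := (isPositive_of_dense_eigenvectors hD hV hd hf hT).isSymmetric
  refine hd.eq_of_inner_left ℂ fun y hy => ?_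
  induction hy using Submodule.iSup_induction' with
  | zero => simp
  | add a b _ _ ha hb => rw [inner_add_right, inner_add_right, ha, hb]
  | mem m y hy =>
    have h1 : ⟪T x, y⟫_ℂ = ⟪x, T y⟫_ℂ := hs x y
    rw [h1, hT m y hy, inner_smul_left, inner_smul_right, Complex.conj_ofReal]
    by_cases hlm : l = m
    · rw [hlm]
    · rw [inner_eq_zero_of_mem_diracEigenspace hD hlm hx (hV m hy), mul_zero, mul_zero]

end Spectral

end NCCovering

end

noncomputable section

namespace NCCovering

/-! ### Eigenvalue multiplicities under similarity -/

section Multiplicity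

open Cardinal

/-- Eigenvectors with eigenvalue at least `t` do not form a subspace, but a spanning set contains a
basis of its span, so counting them amounts to a rank. -/
theorem exists_linearIndependent_mem_iff {H : Type*} [AddCommGroup H] [Module ℂ H] (A : Set H)
    (k : ℕ) : (∃ v : Fin k → H, LinearIndependent ℂ v ∧ ∀ i, v i ∈ A) ↔
      (k : Cardinal) ≤ Module.rank ℂ (Submodule.span ℂ A) := by
  constructor
  · rintro ⟨v, hv, hA⟩
    refine Module.le_rank_iff.2 ⟨fun i => ⟨v i, Submodule.subset_span (hA i)⟩, ?_⟩
    exact LinearIndependent.of_comp (Submodule.span ℂ A).subtype hv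
  · intro h
    obtain ⟨b, hbA, hspan, hb⟩ := exists_linearIndependent ℂ A
    rw [← hspan, rank_span_set hb] at h
    have h' : Cardinal.lift #(Fin k) ≤ Cardinal.lift.{0} #b := by simpa using h
    obtain ⟨e⟩ := Cardinal.lift_mk_le'.1 h'
    exact ⟨fun i => (e i : H), hb.comp e e.injective, fun i => hbA (e i).2⟩

/-- For finite `c` this is `k < n c ↔ ⌊k/n⌋ < c`; an infinite `c` satisfies both sides. -/
theorem natCast_succ_le_mul_iff {n : ℕ} (hn : 0 < n) (k : ℕ) (c : Cardinal) :
    ((k + 1 : ℕ) : Cardinal) ≤ n * c ↔ ((k / n + 1 : ℕ) : Cardinal) ≤ c := by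
  rcases lt_or_ge c ℵ₀ with hc | hc
  · obtain ⟨m, rfl⟩ := Cardinal.lt_aleph0.1 hc
    rw [← Nat.cast_mul, Nat.cast_le, Nat.cast_le, Nat.succ_le_iff, Nat.succ_le_iff,
      Nat.div_lt_iff_lt_mul hn, mul_comm]
  · have h1 : c ≤ n * c := by
      calc c = 1 * c := (one_mul c).symm
        _ ≤ n * c := by gcongr; exact_mod_cast hn
    exact ⟨fun _ => natCast_le_aleph0.trans hc, fun _ => natCast_le_aleph0.trans (hc.trans h1)⟩

theorem natCast_le_mul_lift_iff.{u, v} (k n : ℕ) (c : Cardinal.{u}) :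
    (k : Cardinal.{max u v}) ≤ n * Cardinal.lift.{v} c ↔ (k : Cardinal.{u}) ≤ n * c := by
  rw [← Cardinal.nat_le_lift_iff.{u, v} (a := n * c), Cardinal.lift_mul, Cardinal.lift_natCast]

variable {H H' G : Type*} [NormedAddCommGroup H] [InnerProductSpace ℂ H]
  [NormedAddCommGroup H'] [InnerProductSpace ℂ H'] [Fintype G]

/-- The eigenvectors of `T` with real eigenvalue at least `t`. -/
def eigenvectorsGE (T : H →L[ℂ] H) (t : ℝ) : Set H := {x | ∃ s : ℝ, t ≤ s ∧ T x = (s : ℂ) • x}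

/-- `Φ` maps `E^G` onto the span for `T'`, since an equation `T' x = s x` holds exactly when it
holds in every coordinate. Comparison with natural numbers avoids equating cardinals from different
universes. -/
theorem rank_span_eigenvectorsGE {T : H →L[ℂ] H} {T' : H' →L[ℂ] H'} (Φ : (G → H) ≃L[ℂ] H')
    (hΦ : ∀ ξ : G → H, T' (Φ ξ) = Φ fun g => T (ξ g)) (t : ℝ) (k : ℕ) :
    (k : Cardinal) ≤ Module.rank ℂ (Submodule.span ℂ (eigenvectorsGE T' t)) ↔
      (k : Cardinal) ≤ Fintype.card G * Module.rank ℂ (Submodule.span ℂ (eigenvectorsGE T t)) := by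
  classical
  set E := Submodule.span ℂ (eigenvectorsGE T t) with hE
  let L : (G → E) →ₗ[ℂ] H' := Φ.toLinearEquiv.toLinearMap ∘ₗ E.subtype.compLeft G
  have hL : ∀ η : G → E, L η = Φ fun g => (η g : H) := fun η => rfl
  have hinj : Function.Injective L := by
    intro η ζ h
    have := Φ.injective h
    exact funext fun g => Subtype.ext (congrFun this g)
  have hrange : Submodule.span ℂ (eigenvectorsGE T' t) = LinearMap.range L := by
    apply le_antisymm
    · rw [Submodule.span_le]
      rintro x ⟨s, hs, hx⟩
      have h1 : (fun g => T (Φ.symm x g)) = (s : ℂ) • Φ.symm x := by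
        apply Φ.injective
        rw [← hΦ, Φ.map_smul, Φ.apply_symm_apply, hx]
      refine ⟨fun g => ⟨Φ.symm x g, Submodule.subset_span ⟨s, hs, congrFun h1 g⟩⟩, ?_⟩
      rw [hL]
      exact Φ.apply_symm_apply x
    · rintro _ ⟨η, rfl⟩
      have h1 : ∀ g, E ≤ (Submodule.span ℂ (eigenvectorsGE T' t)).comap
          (Φ.toLinearEquiv.toLinearMap ∘ₗ LinearMap.single ℂ (fun _ => H) g) := by
        intro g
        rw [hE, Submodule.span_le]
        rintro x ⟨s, hs, hx⟩
        refine Submodule.subset_span ⟨s, hs, ?_⟩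
        change T' (Φ (Pi.single g x)) = (s : ℂ) • Φ (Pi.single g x)
        rw [hΦ, ← Φ.map_smul]
        congr 1
        funext h
        by_cases hg : h = g
        · subst hg
          simpa using hx
        · simp [hg]
      rw [hL, ← Finset.univ_sum_single (fun g => (η g : H)), map_sum]
      exact Submodule.sum_mem _ fun g _ => h1 g (η g).2
  have hrank := lift_rank_range_of_injective L hinj
  rw [rank_fun_eq_lift_mul] at hrank
  rw [hrange, ← Cardinal.nat_le_lift_iff, hrank, Cardinal.nat_le_lift_iff]
  exact natCast_le_mul_lift_iff k _ _

theorem singularValue_eq [CompleteSpace H] {T : H →L[ℂ] H} (hT : T.IsPositive) (k : ℕ) :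
    singularValue T k = sSup {t : ℝ | 0 ≤ t ∧ ((k + 1 : ℕ) : Cardinal) ≤
      Module.rank ℂ (Submodule.span ℂ (eigenvectorsGE T t))} := by
  rw [singularValue, CFC.abs_of_nonneg T ((ContinuousLinearMap.nonneg_iff_isPositive T).2 hT)]
  congr 1
  ext t
  exact and_congr_right fun _ => exists_linearIndependent_mem_iff (eigenvectorsGE T t) (k + 1)

/-- If `T'` is similar to the direct sum of `|G|` copies of `T`, every singular value of `T` occurs
`|G|` times in the sequence of those of `T'`. -/
theorem singularValue_of_similar [CompleteSpace H] [CompleteSpace H'] [Nonempty G]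
    {T : H →L[ℂ] H} {T' : H' →L[ℂ] H'} (hT : T.IsPositive) (hT' : T'.IsPositive)
    (Φ : (G → H) ≃L[ℂ] H') (hΦ : ∀ ξ : G → H, T' (Φ ξ) = Φ fun g => T (ξ g)) (k : ℕ) :
    singularValue T' k = singularValue T (k / Fintype.card G) := by
  rw [singularValue_eq hT, singularValue_eq hT']
  simp only [rank_span_eigenvectorsGE Φ hΦ, natCast_succ_le_mul_iff Fintype.card_pos]

end Multiplicity

end NCCovering

end

noncomputable section

namespace NCCovering

/-! ### Asymptotics of partial sums and Cesàro means -/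

section Asymptotics

open Filter Topology

variable {H H' : Type*} [NormedAddCommGroup H] [InnerProductSpace ℂ H] [CompleteSpace H]
  [NormedAddCommGroup H'] [InnerProductSpace ℂ H'] [CompleteSpace H']

theorem singularValue_nonneg (T : H →L[ℂ] H) (k : ℕ) : 0 ≤ singularValue T k :=
  Real.sSup_nonneg fun _ ht => ht.1

theorem sigmaNat_succ (T : H →L[ℂ] H) (n : ℕ) :
    sigmaNat T (n + 1) = sigmaNat T n + singularValue T n :=
  Finset.sum_range_succ _ _

theorem sigmaNat_mono (T : H →L[ℂ] H) : Monotone (sigmaNat T) :=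
  monotone_nat_of_le_succ fun n => by
    rw [sigmaNat_succ]
    exact le_add_of_nonneg_right (singularValue_nonneg T n)

theorem sigma_eq (T : H →L[ℂ] H) (u : ℝ) :
    sigma T u = sigmaNat T ⌊u⌋₊ + Int.fract u * singularValue T ⌊u⌋₊ := by
  rw [sigma, sigmaNat_succ]
  ring

theorem fract_eq_sub_natFloor {u : ℝ} (hu : 0 ≤ u) : Int.fract u = u - ⌊u⌋₊ := by
  rw [← Int.self_sub_floor, natCast_floor_eq_intCast_floor hu]

theorem sigma_mono (T : H →L[ℂ] H) {u v : ℝ} (hu : 0 ≤ u) (huv : u ≤ v) :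
    sigma T u ≤ sigma T v := by
  have hv : 0 ≤ v := hu.trans huv
  rw [sigma_eq, sigma_eq]
  rcases (Nat.floor_mono huv).eq_or_lt with h | h
  · rw [fract_eq_sub_natFloor hu, fract_eq_sub_natFloor hv, ← h]
    have := singularValue_nonneg T ⌊u⌋₊
    gcongr
  · have h1 := singularValue_nonneg T ⌊u⌋₊
    have h2 : sigmaNat T (⌊u⌋₊ + 1) ≤ sigmaNat T ⌊v⌋₊ := sigmaNat_mono T h
    have h3 := mul_nonneg (Int.fract_nonneg v) (singularValue_nonneg T ⌊v⌋₊)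
    have h4 := mul_le_of_le_one_left h1 (Int.fract_lt_one u).le
    rw [sigmaNat_succ] at h2
    linarith

theorem sigma_nonneg (T : H →L[ℂ] H) {u : ℝ} (hu : 0 ≤ u) : 0 ≤ sigma T u := by
  refine le_trans ?_ (sigma_mono T le_rfl hu)
  simp [sigma_eq, sigmaNat]

/-- If every singular value of `T` is repeated `n` times to obtain those of `T'`, then
`σ_{nu}(T') = n σ_u(T)`. -/
theorem sigma_mul {T : H →L[ℂ] H} {T' : H' →L[ℂ] H'} {n : ℕ} (hn : 0 < n)
    (h : ∀ k, singularValue T' k = singularValue T (k / n)) {u : ℝ} (hu : 0 ≤ u) :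
    sigma T' (n * u) = n * sigma T u := by
  -- On the block of indices from `n m` to `n m + n - 1` the singular values of `T'` are constant,
  -- so `σ(T')` is linear there.
  have hpart : ∀ m j : ℕ, j ≤ n → sigmaNat T' (n * m) = n * sigmaNat T m →
      sigmaNat T' (n * m + j) = n * sigmaNat T m + j * singularValue T m := by
    intro m j hj hm
    induction j with
    | zero => simp [hm]
    | succ j ih =>
      rw [← add_assoc, sigmaNat_succ, ih (by omega), h, Nat.mul_add_div hn,
        Nat.div_eq_of_lt (by omega)]
      push_cast
      simp only [add_zero]
      ring
  have hmul : ∀ m : ℕ, sigmaNat T' (n * m) = n * sigmaNat T m := by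
    intro m
    induction m with
    | zero => simp [sigmaNat]
    | succ m ih => rw [Nat.mul_succ, hpart m n le_rfl ih, sigmaNat_succ, mul_add]
  have hn' : (0 : ℝ) < n := by exact_mod_cast hn
  set m := ⌊u⌋₊ with hm
  -- `j` is the position of `⌊n u⌋` inside the block number `m = ⌊u⌋`.
  set j := ⌊n * (u - m)⌋₊ with hj
  have h0 : 0 ≤ u - m := sub_nonneg.2 (Nat.floor_le hu)
  have h1 : u - m < 1 := by linarith [Nat.lt_floor_add_one u]
  have hjn : j < n := by
    rw [hj, Nat.floor_lt (by positivity)]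
    nlinarith
  have hfloor : ⌊n * u⌋₊ = n * m + j := by
    have : (n : ℝ) * u = n * (u - m) + ((n * m : ℕ) : ℝ) := by push_cast; ring
    rw [this, Nat.floor_add_natCast (by positivity), add_comm]
  rw [sigma_eq, sigma_eq, fract_eq_sub_natFloor hu, fract_eq_sub_natFloor (by positivity), hfloor,
    hpart m j hjn.le (hmul m), h, Nat.mul_add_div hn, Nat.div_eq_of_lt hjn, ← hm]
  push_cast
  rw [add_zero]
  ring

theorem sigma_le_of_memDixmierIdeal {T : H →L[ℂ] H} (hT : MemDixmierIdeal T) :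
    ∃ C : ℝ, 0 ≤ C ∧ ∀ u : ℝ, Real.exp 1 < u → sigma T u ≤ C * Real.log u := by
  obtain ⟨_, C, hC⟩ := hT
  refine ⟨max C 0, le_max_right _ _, fun u hu => ?_⟩
  have hlog : 0 < Real.log u :=
    zero_lt_one.trans ((Real.lt_log_iff_exp_lt ((Real.exp_pos 1).trans hu)).2 hu)
  rw [← div_le_iff₀ hlog]
  exact (hC u hu).trans (le_max_left _ _)

/-- Monotonicity of `σ` yields `σ_u(T') = n σ_{u/n}(T) ≤ n σ_u(T)`; conversely `σ_u(T) ≤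
σ_{nu}(T')`. -/
theorem memDixmierIdeal_iff_of_sigma_mul {T : H →L[ℂ] H} {T' : H' →L[ℂ] H'} {n : ℕ} (hn : 0 < n)
    (hc : IsCompactOperator T ↔ IsCompactOperator T')
    (h : ∀ u : ℝ, 0 ≤ u → sigma T' (n * u) = n * sigma T u) :
    MemDixmierIdeal T ↔ MemDixmierIdeal T' := by
  have hn' : (1 : ℝ) ≤ n := by exact_mod_cast hn
  have he : ∀ {u : ℝ}, Real.exp 1 < u → 0 < u ∧ 1 < Real.log u := fun hu =>
    ⟨(Real.exp_pos 1).trans hu, (Real.lt_log_iff_exp_lt ((Real.exp_pos 1).trans hu)).2 hu⟩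
  constructor
  · intro hT
    obtain ⟨C, hC0, hC⟩ := sigma_le_of_memDixmierIdeal hT
    refine ⟨hc.1 hT.1, n * C, fun u hu => ?_⟩
    obtain ⟨hu0, hlog⟩ := he hu
    rw [div_le_iff₀ (by linarith)]
    calc sigma T' u = n * sigma T (u / n) := by
          rw [← h _ (by positivity), mul_div_cancel₀ _ (by positivity)]
      _ ≤ n * sigma T u := by
          gcongr
          exact sigma_mono T (by positivity) (div_le_self hu0.le hn')
      _ ≤ n * C * Real.log u := by
          rw [mul_assoc]
          gcongr
          exact hC u hu
  · intro hT'
    obtain ⟨C, hC0, hC⟩ := sigma_le_of_memDixmierIdeal hT'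
    -- For `u > e` one has `log u > 1`, hence `log (n u) ≤ (log n + 1) log u`.
    refine ⟨hc.2 hT'.1, C * (Real.log n + 1), fun u hu => ?_⟩
    obtain ⟨hu0, hlog⟩ := he hu
    rw [div_le_iff₀ (by linarith)]
    have hσ := sigma_nonneg T hu0.le
    have hlogn : 0 ≤ Real.log n := Real.log_nonneg hn'
    calc sigma T u ≤ n * sigma T u := le_mul_of_one_le_left hσ hn'
      _ = sigma T' (n * u) := (h u hu0.le).symm
      _ ≤ C * Real.log (n * u) := hC _ (hu.trans_le (le_mul_of_one_le_left hu0.le hn'))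
      _ ≤ C * (Real.log n + 1) * Real.log u := by
          rw [Real.log_mul (by positivity) (by positivity), mul_assoc]
          gcongr
          nlinarith

theorem integral_inv_mul_inv_log {r : ℝ} (hr : Real.exp 1 ≤ r) :
    ∫ v in (Real.exp 1)..r, v⁻¹ / Real.log v = Real.log (Real.log r) := by
  have hpos : ∀ v ∈ Set.uIcc (Real.exp 1) r, 0 < v ∧ 1 ≤ Real.log v := by
    intro v hv
    rw [Set.uIcc_of_le hr] at hv
    have hv0 := (Real.exp_pos 1).trans_le hv.1
    exact ⟨hv0, (Real.le_log_iff_exp_le hv0).2 hv.1⟩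
  rw [intervalIntegral.integral_eq_sub_of_hasDerivAt (f := fun v => Real.log (Real.log v))]
  · simp
  · intro v hv
    obtain ⟨h0, h1⟩ := hpos v hv
    exact (Real.hasDerivAt_log h0.ne').log (by linarith)
  · refine ContinuousOn.intervalIntegrable fun v hv => ContinuousAt.continuousWithinAt ?_
    obtain ⟨h0, h1⟩ := hpos v hv
    exact (continuousAt_inv₀ h0.ne').div (Real.continuousAt_log h0.ne') (by linarith)

/-- Used with `κ = n` and `κ = 1`. Monotone functions are integrable, and `1 < κ * a` keeps the
logarithm away from its zero. -/
theorem intervalIntegrable_sigma_div_log (T : H →L[ℂ] H) {κ a b : ℝ} (hκ : 0 < κ) (ha : 0 < a)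
    (hab : a ≤ b) (h : 1 < κ * a) :
    IntervalIntegrable (fun v => sigma T v / Real.log (κ * v) * (1 / v)) MeasureTheory.volume
      a b := by
  have hσ : IntervalIntegrable (sigma T) MeasureTheory.volume a b := by
    refine MonotoneOn.intervalIntegrable fun u hu v _ huv => sigma_mono T ?_ huv
    rw [Set.uIcc_of_le hab] at hu
    exact ha.le.trans hu.1
  have hc : ContinuousOn (fun v : ℝ => (Real.log (κ * v))⁻¹ * (1 / v)) (Set.uIcc a b) := by
    intro v hv
    rw [Set.uIcc_of_le hab] at hv
    have hv0 : 0 < v := ha.trans_le hv.1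
    have hlog : Real.log (κ * v) ≠ 0 :=
      (Real.log_pos (h.trans_le (mul_le_mul_of_nonneg_left hv.1 hκ.le))).ne'
    have hκv : κ * v ≠ 0 := (mul_pos hκ hv0).ne'
    refine ContinuousAt.continuousWithinAt ?_
    fun_prop (disch := first | assumption | exact hv0.ne')
  refine (hσ.mul_continuousOn hc).congr fun v _ => ?_
  ring

theorem tendsto_log_log_div_log :
    Tendsto (fun r : ℝ => Real.log (Real.log r) / Real.log r) atTop (𝓝 0) :=
  (Real.isLittleO_log_id_atTop.tendsto_div_nhds_zero).comp Real.tendsto_log_atTop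

/-- The difference between `∫_e^r σ_u(T) / (u log u) du` and its rescaled version is
`O(log log r)`. -/
theorem abs_integral_rescaled_sub_le (T : H →L[ℂ] H) {n : ℝ} (hn : 1 ≤ n) {C : ℝ} (hC0 : 0 ≤ C)
    (hC : ∀ u : ℝ, Real.exp 1 < u → sigma T u ≤ C * Real.log u) :
    ∃ A : ℝ, ∀ r : ℝ, n * Real.exp 1 < r →
      |(∫ v in (Real.exp 1 / n)..(r / n), sigma T v / Real.log (n * v) * (1 / v)) -
        ∫ v in (Real.exp 1)..r, sigma T v / Real.log v * (1 / v)| ≤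
      A + C * Real.log n * Real.log (Real.log r) := by
  have hn0 : 0 < n := zero_lt_one.trans_le hn
  have hlogn : 0 ≤ Real.log n := Real.log_nonneg hn
  have he : 1 < Real.exp 1 := by simp
  have hep := Real.exp_pos 1
  set g : ℝ → ℝ := fun v => sigma T v / Real.log (n * v) * (1 / v) with hg
  set w : ℝ → ℝ := fun v => sigma T v / Real.log v * (1 / v) with hw
  -- The first summand is the piece over `[e/n, e]`, independent of `r`; the second bounds the tail
  -- over `[r/n, r]`.
  refine ⟨|∫ v in (Real.exp 1 / n)..(Real.exp 1), g v| + C * Real.log n, fun r hr => ?_⟩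
  have her : Real.exp 1 < r / n := by rwa [lt_div_iff₀ hn0, mul_comm]
  have hr0 : 0 < r := (mul_pos hn0 hep).trans hr
  have hrn : r / n ≤ r := div_le_self hr0.le hn
  have hner : Real.exp 1 / n ≤ Real.exp 1 := div_le_self hep.le hn
  have hne : 1 < n * Real.exp 1 := by nlinarith
  have i1 : IntervalIntegrable g MeasureTheory.volume (Real.exp 1 / n) (Real.exp 1) :=
    intervalIntegrable_sigma_div_log T hn0 (by positivity) hner
      (by rwa [mul_div_cancel₀ _ hn0.ne'])
  have i2 : IntervalIntegrable g MeasureTheory.volume (Real.exp 1) (r / n) :=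
    intervalIntegrable_sigma_div_log T hn0 hep her.le hne
  have i3 : IntervalIntegrable g MeasureTheory.volume (r / n) r :=
    intervalIntegrable_sigma_div_log T hn0 (by positivity) hrn
      (by rw [mul_div_cancel₀ _ hn0.ne']; nlinarith)
  have i4 : IntervalIntegrable w MeasureTheory.volume (Real.exp 1) r := by
    have := intervalIntegrable_sigma_div_log T one_pos hep (her.le.trans hrn) (by simp)
    simpa only [one_mul] using this
  have hsplit : (∫ v in (Real.exp 1 / n)..(r / n), g v) - ∫ v in (Real.exp 1)..r, w v =
      (∫ v in (Real.exp 1 / n)..(Real.exp 1), g v) - (∫ v in (Real.exp 1)..r, (w v - g v)) -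
        ∫ v in (r / n)..r, g v := by
    rw [intervalIntegral.integral_sub i4 (i2.trans i3),
      ← intervalIntegral.integral_add_adjacent_intervals i1 i2,
      ← intervalIntegral.integral_add_adjacent_intervals i2 i3]
    ring
  have hdiff : |∫ v in (Real.exp 1)..r, (w v - g v)| ≤
      C * Real.log n * Real.log (Real.log r) := by
    rw [← integral_inv_mul_inv_log (her.le.trans hrn), ← intervalIntegral.integral_const_mul]
    rw [← Real.norm_eq_abs]
    refine intervalIntegral.norm_integral_le_of_norm_le (her.le.trans hrn) ?_ ?_
    · refine Filter.Eventually.of_forall fun v hv => ?_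
      have hv0 : 0 < v := hep.trans hv.1
      have hl : 1 < Real.log v := (Real.lt_log_iff_exp_lt hv0).2 hv.1
      have hl' : 1 < Real.log n + Real.log v := by linarith
      have hσ := sigma_nonneg T hv0.le
      -- `1/log v - 1/log (nv) = log n / (log v · log (nv))`. With `σ_v ≤ C log v` and `log (nv) ≥
      -- log v` this leaves `C log n / (v log v)`, whose integral is `C log n · log log r`.
      have heq : w v - g v = sigma T v * Real.log n /
          (Real.log v * (Real.log n + Real.log v) * v) := by
        rw [hw, hg]
        simp only
        rw [Real.log_mul hn0.ne' hv0.ne']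
        field_simp
        ring
      rw [heq, Real.norm_of_nonneg (by positivity)]
      have heq' : C * Real.log n * (v⁻¹ / Real.log v) =
          (C * Real.log v) * Real.log n / (Real.log v * Real.log v * v) := by
        field_simp
      rw [heq']
      have hlv : 0 < Real.log v := by linarith
      gcongr
      · exact hC v hv.1
      · linarith
    · refine (ContinuousOn.intervalIntegrable fun v hv => ContinuousAt.continuousWithinAt ?_)
      rw [Set.uIcc_of_le (her.le.trans hrn)] at hv
      have hv0 : 0 < v := hep.trans_le hv.1
      have hl : 1 ≤ Real.log v := (Real.le_log_iff_exp_le hv0).2 hv.1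
      exact continuousAt_const.mul
        ((continuousAt_inv₀ hv0.ne').div (Real.continuousAt_log hv0.ne') (by linarith))
  -- Since `r/n > e`, the bound `σ_v ≤ C log v ≤ C log (nv)` holds on the whole tail, and the
  -- integrand is at most `C / v`.
  have hlast : |∫ v in (r / n)..r, g v| ≤ C * Real.log n := by
    have h1 : ∫ v in (r / n)..r, C * v⁻¹ = C * Real.log n := by
      rw [intervalIntegral.integral_const_mul, integral_inv_of_pos (by positivity) hr0,
        div_div_cancel₀ hr0.ne']
    rw [← h1]
    rw [← Real.norm_eq_abs]
    refine intervalIntegral.norm_integral_le_of_norm_le hrn ?_ ?_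
    · refine Filter.Eventually.of_forall fun v hv => ?_
      have hv1 : Real.exp 1 < v := her.trans hv.1
      have hv0 : 0 < v := hep.trans hv1
      have hl : 1 < Real.log v := (Real.lt_log_iff_exp_lt hv0).2 hv1
      have hσ := sigma_nonneg T hv0.le
      have hl' : 1 < Real.log n + Real.log v := by linarith
      rw [hg]
      simp only
      rw [Real.log_mul hn0.ne' hv0.ne', Real.norm_of_nonneg (by positivity), one_div]
      gcongr
      rw [div_le_iff₀ (by linarith)]
      refine (hC v hv1).trans ?_
      gcongr
      linarith
    · refine (ContinuousOn.intervalIntegrable fun v hv => ContinuousAt.continuousWithinAt ?_)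
      rw [Set.uIcc_of_le hrn] at hv
      exact continuousAt_const.mul (continuousAt_inv₀ ((hep.trans her).trans_le hv.1).ne')
  rw [hsplit]
  have := abs_sub ((∫ v in (Real.exp 1 / n)..(Real.exp 1), g v) -
    ∫ v in (Real.exp 1)..r, (w v - g v)) (∫ v in (r / n)..r, g v)
  have := abs_sub (∫ v in (Real.exp 1 / n)..(Real.exp 1), g v)
    (∫ v in (Real.exp 1)..r, (w v - g v))
  linarith

/-- No convergence of `τ` is assumed, so existence of the limit passes in either direction. -/
theorem tendsto_tau_sub {T : H →L[ℂ] H} {T' : H' →L[ℂ] H'} {n : ℕ} (hn : 0 < n)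
    (hT : MemDixmierIdeal T) (h : ∀ u : ℝ, 0 ≤ u → sigma T' (n * u) = n * sigma T u) :
    Tendsto (fun r => tau T' r - n * tau T r) atTop (𝓝 0) := by
  obtain ⟨C, hC0, hC⟩ := sigma_le_of_memDixmierIdeal hT
  have hn1 : (1 : ℝ) ≤ n := by exact_mod_cast hn
  have hn0 : (0 : ℝ) < n := zero_lt_one.trans_le hn1
  obtain ⟨A, hA⟩ := abs_integral_rescaled_sub_le T hn1 hC0 hC
  have hlim : Tendsto (fun r : ℝ => n * (A / Real.log r +
      C * Real.log n * (Real.log (Real.log r) / Real.log r))) atTop (𝓝 0) := by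
    have h1 : Tendsto (fun r : ℝ => A / Real.log r) atTop (𝓝 0) :=
      tendsto_const_nhds.div_atTop Real.tendsto_log_atTop
    have h2 := (h1.add (tendsto_log_log_div_log.const_mul (C * Real.log n))).const_mul (n : ℝ)
    simpa using h2
  refine squeeze_zero_norm' ?_ hlim
  filter_upwards [eventually_gt_atTop (n * Real.exp 1)] with r hr
  have her : Real.exp 1 < r := (le_mul_of_one_le_left (Real.exp_pos 1).le hn1).trans_lt hr
  have hr0 : 0 < r := (Real.exp_pos 1).trans her
  have hlog : 0 < Real.log r := zero_lt_one.trans ((Real.lt_log_iff_exp_lt hr0).2 her)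
  -- Substitution `u = n v`: the measure `du/u` is invariant and `σ_u(T') = n σ_v(T)` supplies the
  -- factor `n`.
  have hsub : ∫ u in (Real.exp 1)..r, sigma T' u / Real.log u * (1 / u) =
      n * ∫ v in (Real.exp 1 / n)..(r / n), sigma T v / Real.log (n * v) * (1 / v) := by
    rw [← smul_eq_mul, ← intervalIntegral.integral_comp_div
      (fun v => sigma T v / Real.log (n * v) * (1 / v)) hn0.ne']
    refine intervalIntegral.integral_congr fun u hu => ?_
    rw [Set.uIcc_of_le her.le] at hu
    have hu0 : 0 < u := (Real.exp_pos 1).trans_le hu.1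
    have h1 := h (u / n) (by positivity)
    rw [mul_div_cancel₀ _ hn0.ne'] at h1
    rw [h1, mul_div_cancel₀ _ hn0.ne', one_div_div]
    ring
  have heq : tau T' r - n * tau T r = n * (((∫ v in (Real.exp 1 / n)..(r / n),
      sigma T v / Real.log (n * v) * (1 / v)) -
        ∫ v in (Real.exp 1)..r, sigma T v / Real.log v * (1 / v)) / Real.log r) := by
    rw [tau, tau, hsub]
    ring
  rw [heq, Real.norm_eq_abs, abs_mul, abs_div, abs_of_pos hn0, abs_of_pos hlog]
  gcongr
  rw [div_add' _ _ _ hlog.ne', div_le_div_iff_of_pos_right hlog]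
  refine (hA r hr).trans (le_of_eq ?_)
  field_simp

theorem hasNCIntegral_iff_of_singularValue {T : H →L[ℂ] H} {T' : H' →L[ℂ] H'} {n : ℕ} (hn : 0 < n)
    (hT : T.IsPositive) (hT' : T'.IsPositive) (hc : IsCompactOperator T ↔ IsCompactOperator T')
    (h : ∀ k, singularValue T' k = singularValue T (k / n)) (c : ℝ) :
    HasNCIntegral T c ↔ HasNCIntegral T' (n * c) := by
  have hσ : ∀ u : ℝ, 0 ≤ u → sigma T' (n * u) = n * sigma T u := fun u hu => sigma_mul hn h hu
  have hmem := memDixmierIdeal_iff_of_sigma_mul hn hc hσ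
  have hn0 : (n : ℝ) ≠ 0 := by exact_mod_cast hn.ne'
  constructor
  · rintro ⟨_, hm, ht⟩
    refine ⟨hT', hmem.1 hm, ?_⟩
    simpa using (tendsto_tau_sub hn hm hσ).add (ht.const_mul (n : ℝ))
  · rintro ⟨_, hm, ht⟩
    have hm' := hmem.2 hm
    refine ⟨hT, hm', ?_⟩
    have h1 := (ht.sub (tendsto_tau_sub hn hm' hσ)).const_mul (n : ℝ)⁻¹
    simpa [hn0] using h1

end Asymptotics

end NCCovering

end

noncomputable section

namespace NCCovering

/-! ### Sheets of the covering and transfer of operators -/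

section Main

variable {𝒜 𝒜' H H' G : Type*}
  [Ring 𝒜] [StarRing 𝒜] [Algebra ℂ 𝒜] [StarModule ℂ 𝒜]
  [Ring 𝒜'] [StarRing 𝒜'] [Algebra ℂ 𝒜'] [StarModule ℂ 𝒜']
  [NormedAddCommGroup H] [InnerProductSpace ℂ H] [CompleteSpace H]
  [NormedAddCommGroup H'] [InnerProductSpace ℂ H'] [CompleteSpace H']
  [Group G] [Fintype G]
  {S : SpectralTriple 𝒜 H} {S' : SpectralTriple 𝒜' H'}

namespace LocalCovering

/-- The copy `g φ⁻¹ : H → H'` of `H` inside `H'`. -/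
def sheet (L : LocalCovering S S' G) (g : G) : H →L[ℂ] H' :=
  ((L.U g).toContinuousLinearEquiv.toContinuousLinearMap).comp
    (L.hat.subtypeL.comp L.φ.symm.toContinuousLinearMap)

theorem sheet_apply (L : LocalCovering S S' G) (g : G) (x : H) :
    L.sheet g x = L.U g (L.φ.symm x : H') := rfl

/-- The decomposition of `H'` into sheets. -/
def sheetSum (L : LocalCovering S S' G) : (G → H) →L[ℂ] H' :=
  ∑ g, (L.sheet g).comp (ContinuousLinearMap.proj g)

theorem sheetSum_apply (L : LocalCovering S S' G) (ξ : G → H) :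
    L.sheetSum ξ = ∑ g, L.sheet g (ξ g) := by
  simp [sheetSum]

theorem inner_sheet_eq_zero (L : LocalCovering S S' G) {g h : G} (hgh : g ≠ h) (x y : H) :
    inner ℂ (L.sheet g x) (L.sheet h y) = 0 :=
  L.orthogonal g h hgh _ (L.φ.symm x).2 _ (L.φ.symm y).2

theorem sheet_injective (L : LocalCovering S S' G) (g : G) : Function.Injective (L.sheet g) :=
  (L.U g).injective.comp (Subtype.val_injective.comp L.φ.symm.injective)

theorem sheetSum_ker (L : LocalCovering S S' G) : L.sheetSum.ker = ⊥ := by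
  rw [LinearMap.ker_eq_bot']
  intro ξ hξ
  have hξ' : ∑ h, L.sheet h (ξ h) = 0 := by
    rw [← sheetSum_apply]
    exact hξ
  funext g
  apply L.sheet_injective g
  -- Pairing with the `g`-th summand isolates it, because distinct sheets are orthogonal.
  have h1 : inner ℂ (L.sheet g (ξ g)) (∑ h, L.sheet h (ξ h)) =
      inner ℂ (L.sheet g (ξ g)) (L.sheet g (ξ g)) := by
    rw [inner_sum]
    exact Finset.sum_eq_single g (fun h _ hh => L.inner_sheet_eq_zero hh.symm _ _) (by simp)
  rw [hξ', inner_zero_right] at h1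
  rw [Pi.zero_apply, map_zero]
  exact inner_self_eq_zero.1 h1.symm

theorem sheetSum_single [DecidableEq G] (L : LocalCovering S S' G) (g : G) (x : H) :
    L.sheetSum (Pi.single g x) = L.sheet g x := by
  rw [sheetSum_apply, Finset.sum_eq_single g]
  · simp
  · intro h _ hh
    simp [hh]
  · simp

theorem sheetSum_range (L : LocalCovering S S' G) : L.sheetSum.range = ⊤ := by
  classical
  rw [eq_top_iff, ← L.spanning, iSup_le_iff]
  rintro g _ ⟨ξ, hξ, rfl⟩
  refine ⟨Pi.single g (L.φ ⟨ξ, hξ⟩), ?_⟩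
  refine (L.sheetSum_single g _).trans ?_
  rw [sheet_apply, L.φ.symm_apply_apply]
  rfl

/-- The isomorphism of `H'` with a direct sum of copies of `H`. -/
def sheetEquiv (L : LocalCovering S S' G) : (G → H) ≃L[ℂ] H' :=
  ContinuousLinearEquiv.ofBijective L.sheetSum L.sheetSum_ker L.sheetSum_range

theorem sheetEquiv_apply (L : LocalCovering S S' G) (ξ : G → H) :
    L.sheetEquiv ξ = ∑ g, L.sheet g (ξ g) :=
  L.sheetSum_apply ξ

theorem sheetEquiv_symm_sheet [DecidableEq G] (L : LocalCovering S S' G) (g : G) (x : H) :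
    L.sheetEquiv.symm (L.sheet g x) = Pi.single g x :=
  L.sheetEquiv.symm_apply_eq.2 (L.sheetSum_single g x).symm

/-- Conditions (a)-(c) lift an eigenvector to `Ĥ` through `φ⁻¹`, and equivariance of `D'` moves it
to `g Ĥ`. -/
theorem sheet_mem_diracEigenspace (L : LocalCovering S S' G) (g : G) {l : ℝ} {x : H}
    (hx : x ∈ diracEigenspace S.D l) : L.sheet g x ∈ diracEigenspace S'.D l := by
  obtain ⟨hx, hx'⟩ := hx
  have hm : (L.φ.symm x : H') ∈ S'.D.domain :=
    (L.domain_iff _).2 (by rwa [L.φ.apply_symm_apply])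
  have h1 : L.φ ⟨_, L.map_hat _ hm⟩ = (l : ℂ) • x := by
    rw [← L.dirac_comm, ← hx']
    congr 1
    exact Subtype.ext (L.φ.apply_symm_apply x)
  have h2 : S'.D ⟨_, hm⟩ = (l : ℂ) • (L.φ.symm x : H') := by
    have h3 := congrArg L.φ.symm h1
    rw [L.φ.symm_apply_apply, map_smul] at h3
    exact congrArg Subtype.val h3
  refine ⟨L.equivariant_mem g ⟨_, hm⟩, ?_⟩
  refine (L.equivariant g ⟨_, hm⟩).trans ?_
  rw [h2, map_smul, sheet_apply]

/-- The eigenvectors of `D'` obtained from those of `D`. -/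
def liftedEigenspace (L : LocalCovering S S' G) (l : ℝ) : Submodule ℂ H' :=
  ⨆ g, (diracEigenspace S.D l).map (L.sheet g : H →ₗ[ℂ] H')

theorem liftedEigenspace_le (L : LocalCovering S S' G) (l : ℝ) :
    L.liftedEigenspace l ≤ diracEigenspace S'.D l := by
  refine iSup_le fun g => ?_
  rintro _ ⟨x, hx, rfl⟩
  exact L.sheet_mem_diracEigenspace g hx

/-- Each sheet is continuous, so it sends the dense span of eigenvectors of `D` to a dense subset of
its image, and the images together span `H'`. -/
theorem dense_liftedEigenspace (L : LocalCovering S S' G) :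
    Dense ((⨆ l, L.liftedEigenspace l : Submodule ℂ H') : Set H') := by
  set M := (⨆ l, L.liftedEigenspace l : Submodule ℂ H').topologicalClosure with hM
  have hcl : IsClosed (M : Set H') := Submodule.isClosed_topologicalClosure _
  have h1 : ∀ g x, L.sheet g x ∈ M := by
    intro g x
    have hd := dense_iSup_diracEigenspace S.selfAdjoint S.compact_resolvent
    refine (hcl.preimage (L.sheet g).continuous).closure_subset_iff.2 ?_ (hd x)
    have : (⨆ l, diracEigenspace S.D l) ≤ M.comap (L.sheet g : H →ₗ[ℂ] H') := by
      refine iSup_le fun l y hy => Submodule.le_topologicalClosure _ ?_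
      exact Submodule.mem_iSup_of_mem l (Submodule.mem_iSup_of_mem g ⟨y, hy, rfl⟩)
    exact this
  rw [Submodule.dense_iff_topologicalClosure_eq_top, eq_top_iff]
  rintro y -
  rw [← L.sheetEquiv.apply_symm_apply y, sheetEquiv_apply]
  exact Submodule.sum_mem _ fun g _ => h1 g _

/-- If `T = f D` with `f ≥ 0`, then `T' = f D'` exactly when `T'` is the direct sum of copies
of `T`. -/
theorem apply_eq_iff_forall_sheet (L : LocalCovering S S' G) {f : ℝ → ℝ} (hf : ∀ l, 0 ≤ f l)
    {T : H →L[ℂ] H} (hT : ∀ l, ∀ x ∈ diracEigenspace S.D l, T x = (f l : ℂ) • x)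
    (T' : H' →L[ℂ] H') :
    (∀ l, ∀ x ∈ diracEigenspace S'.D l, T' x = (f l : ℂ) • x) ↔
      ∀ g x, T' (L.sheet g x) = L.sheet g (T x) := by
  constructor
  · intro h g
    have hd := dense_iSup_diracEigenspace S.selfAdjoint S.compact_resolvent
    have hcl : IsClosed {x | T' (L.sheet g x) = L.sheet g (T x)} :=
      isClosed_eq (by fun_prop) (by fun_prop)
    intro x
    refine hcl.closure_subset_iff.2 ?_ (hd x)
    have hle : (⨆ l, diracEigenspace S.D l) ≤ LinearMap.eqLocus
        (T'.comp (L.sheet g) : H →ₗ[ℂ] H') ((L.sheet g).comp T : H →ₗ[ℂ] H') := by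
      refine iSup_le fun l y hy => ?_
      change T' (L.sheet g y) = L.sheet g (T y)
      rw [hT l y hy, map_smul, h l _ (L.sheet_mem_diracEigenspace g hy)]
    exact hle
  · intro h l x hx
    refine apply_eq_of_dense_eigenvectors S'.selfAdjoint L.liftedEigenspace_le
      L.dense_liftedEigenspace hf ?_ hx
    intro m
    have hle : L.liftedEigenspace m ≤ LinearMap.eqLocus (T' : H' →ₗ[ℂ] H')
        ((f m : ℂ) • LinearMap.id) := by
      refine iSup_le fun g => ?_
      rintro _ ⟨y, hy, rfl⟩
      change T' (L.sheet g y) = (f m : ℂ) • L.sheet g y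
      rw [h, hT m y hy, map_smul]
    exact hle

end LocalCovering

theorem SpectralTriple.isPositive_of_apply_eq (S : SpectralTriple 𝒜 H) {f : ℝ → ℝ}
    (hf : ∀ l, 0 ≤ f l) {T : H →L[ℂ] H}
    (hT : ∀ l, ∀ x ∈ diracEigenspace S.D l, T x = (f l : ℂ) • x) : T.IsPositive :=
  isPositive_of_dense_eigenvectors S.selfAdjoint (fun _ => le_rfl)
    (dense_iSup_diracEigenspace S.selfAdjoint S.compact_resolvent) hf hT

namespace LocalCovering

/-- Noncommutative integrals of `f D` and `f D'`, for a function `f ≥ 0`. -/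
theorem hasNCIntegral_iff (L : LocalCovering S S' G) {f : ℝ → ℝ} (hf : ∀ l, 0 ≤ f l)
    {T : H →L[ℂ] H} (hT : ∀ l, ∀ x ∈ diracEigenspace S.D l, T x = (f l : ℂ) • x)
    {T' : H' →L[ℂ] H'} (hT' : ∀ l, ∀ x ∈ diracEigenspace S'.D l, T' x = (f l : ℂ) • x) (c : ℝ) :
    HasNCIntegral T c ↔ HasNCIntegral T' (Fintype.card G * c) := by
  classical
  have hpos := S.isPositive_of_apply_eq hf hT
  have hpos' := S'.isPositive_of_apply_eq hf hT'
  have hsheet := (L.apply_eq_iff_forall_sheet hf hT T').1 hT'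
  have hΦ : ∀ ξ : G → H, T' (L.sheetEquiv ξ) = L.sheetEquiv fun g => T (ξ g) := by
    intro ξ
    simp only [sheetEquiv_apply, map_sum, hsheet]
  refine hasNCIntegral_iff_of_singularValue Fintype.card_pos hpos hpos' ⟨fun hc => ?_, fun hc => ?_⟩
    (singularValue_of_similar hpos hpos' L.sheetEquiv hΦ) c
  -- Compactness passes up because `T'` is a finite sum of copies of `T` composed with bounded maps,
  -- and down because `T` is the component of `T'` on the sheet of `1`.
  · have h1 : T' = ∑ g, ((L.sheet g).comp T).comp
        ((ContinuousLinearMap.proj g).comp L.sheetEquiv.symm.toContinuousLinearMap) := by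
      ext y
      have := hΦ (L.sheetEquiv.symm y)
      rw [L.sheetEquiv.apply_symm_apply, sheetEquiv_apply] at this
      simpa using this
    rw [h1]
    refine Submodule.sum_mem (compactOperator (RingHom.id ℂ) H' H') fun g _ => (hc.clm_comp (L.sheet g)).comp_clm _
  · have h1 : T = ((ContinuousLinearMap.proj (1 : G)).comp
        L.sheetEquiv.symm.toContinuousLinearMap).comp (T'.comp (L.sheet 1)) := by
      ext x
      simp [hsheet, sheetEquiv_symm_sheet]
    rw [h1]
    exact (hc.comp_clm (L.sheet 1)).clm_comp ((ContinuousLinearMap.proj (1 : G)).comp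
      L.sheetEquiv.symm.toContinuousLinearMap)

/-- Measurability includes the existence of the bounded operator `|D|^{-p}`, so existence has to be
transferred as well; the lift is the direct sum of copies of `T`. -/
theorem exists_lift (L : LocalCovering S S' G) {f : ℝ → ℝ} (hf : ∀ l, 0 ≤ f l)
    {T : H →L[ℂ] H} (hT : ∀ l, ∀ x ∈ diracEigenspace S.D l, T x = (f l : ℂ) • x) :
    ∃ T' : H' →L[ℂ] H', ∀ l, ∀ x ∈ diracEigenspace S'.D l, T' x = (f l : ℂ) • x := by
  classical
  refine ⟨∑ g, ((L.sheet g).comp T).comp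
    ((ContinuousLinearMap.proj g).comp L.sheetEquiv.symm.toContinuousLinearMap), ?_⟩
  rw [L.apply_eq_iff_forall_sheet hf hT]
  intro g x
  rw [sum_apply, Finset.sum_eq_single g]
  · simp [sheetEquiv_symm_sheet]
  · intro h _ hh
    simp [sheetEquiv_symm_sheet, hh]
  · simp

/-- `T` is `T'` read on the sheet of `1`, where the lifted eigenvectors of `D` are eigenvectors of
`D'`. -/
theorem exists_descent (L : LocalCovering S S' G) {f : ℝ → ℝ} {T' : H' →L[ℂ] H'}
    (hT' : ∀ l, ∀ x ∈ diracEigenspace S'.D l, T' x = (f l : ℂ) • x) :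
    ∃ T : H →L[ℂ] H, ∀ l, ∀ x ∈ diracEigenspace S.D l, T x = (f l : ℂ) • x := by
  classical
  refine ⟨((ContinuousLinearMap.proj (1 : G)).comp
    L.sheetEquiv.symm.toContinuousLinearMap).comp (T'.comp (L.sheet 1)), fun l x hx => ?_⟩
  simp [hT' l _ (L.sheet_mem_diracEigenspace 1 hx), sheetEquiv_symm_sheet]

end LocalCovering

end Main

end NCCovering

end

theorem mainTheorem9 {𝒜 𝒜' H H' G : Type*}
    [Ring 𝒜] [StarRing 𝒜] [Algebra ℂ 𝒜] [StarModule ℂ 𝒜]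
    [Ring 𝒜'] [StarRing 𝒜'] [Algebra ℂ 𝒜'] [StarModule ℂ 𝒜']
    [NormedAddCommGroup H] [InnerProductSpace ℂ H] [CompleteSpace H]
    [NormedAddCommGroup H'] [InnerProductSpace ℂ H'] [CompleteSpace H']
    [Group G] [Fintype G]
    (S : NCCovering.SpectralTriple 𝒜 H) (S' : NCCovering.SpectralTriple 𝒜' H')
    (_L : NCCovering.LocalCovering S S' G)
    (p : ℝ) (_hp : 0 < p) (c : ℝ) :
    S.HasDiracIntegral p c ↔ S'.HasDiracIntegral p ((Fintype.card G : ℝ) * c) := by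
  have hf : ∀ l : ℝ, 0 ≤ (if l = 0 then 0 else |l| ^ (-p) : ℝ) := fun l => by
    split_ifs <;> positivity
  simp only [NCCovering.SpectralTriple.HasDiracIntegral, NCCovering.isAbsNegPow_iff]
  constructor
  · rintro ⟨T, hT, hc⟩
    obtain ⟨T', hT'⟩ := _L.exists_lift hf hT
    exact ⟨T', hT', (_L.hasNCIntegral_iff hf hT hT' c).1 hc⟩
  · rintro ⟨T', hT', hc⟩
    obtain ⟨T, hT⟩ := _L.exists_descent hT'
    exact ⟨T, hT, (_L.hasNCIntegral_iff hf hT hT' c).2 hc⟩
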